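/- For a nonzero rational function $f\in\mathbb{C}(z)$ and a set $G\subset\mathbb{C}$, let $\#_z(f,G)$, $\#_p(f,G)$ and $\#_c(f,G)$ denote the numbers of zeros, poles and critical points of $f$ lying in $G$, counted with multiplicity, where the critical points of a nonconstant $f$ are the zeros of the rational function $f'$. For $K\subset\mathbb{C}$ and $\epsilon>0$ let $K_\epsilon=\{z\in\mathbb{C}: |z-w|<\epsilon\text{ for some }w\in K\}$. For positive integers $k\le n$ and $\epsilon>0$, say that $K$ satisfies $\mathcal{RAGL}(n,k,\epsilon)$ if every rational function $f$ with $\#_z(f,\mathbb{C})+\#_p(f,\mathbb{C})=n$ and $\#_z(f,K)\ge k$ satisfies $\#_c(f,K_\epsilon)\ge k-1$. Let $K\subset\mathbb{C}$ be bounded and convex with diameter $s$, and let $k$ and $n$ be positive integers with $k<n$ and $\sqrt{k}>4(n-k)$. If $$\epsilon>\frac{4s(n-k)}{\sqrt{k}-4(n-k)},$$ then $K$ satisfies $\mathcal{RAGL}(n,k,\epsilon)$. -/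

import Mathlib

noncomputable section

namespace GaussLucas

open Polynomial

/-- The derivative `f'` of a rational function `f = p / q` (in lowest terms),
`f' = (p' q - p q') / q ^ 2`, again a rational function. -/
def ratDeriv (f : RatFunc ℂ) : RatFunc ℂ :=
  algebraMap ℂ[X] (RatFunc ℂ) (derivative f.num * f.denom - f.num * derivative f.denom) /
    algebraMap ℂ[X] (RatFunc ℂ) (f.denom ^ 2)

open Classical in
/-- The number of zeros of the nonzero rational function `f` in `G`, with multiplicity:
the roots of the numerator of `f` in lowest terms. -/
def numZeros (f : RatFunc ℂ) (G : Set ℂ) : ℕ := f.num.roots.countP (· ∈ G)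

open Classical in
/-- The number of poles of the rational function `f` in `G`, with multiplicity:
the roots of the denominator of `f` in lowest terms. -/
def numPoles (f : RatFunc ℂ) (G : Set ℂ) : ℕ := f.denom.roots.countP (· ∈ G)

/-- The number of critical points of the nonconstant rational function `f` in `G`, that is, of
zeros of `f'`, with multiplicity. (A pole of `f` is a pole of `f'`, so it is not counted.) -/
def numCrit (f : RatFunc ℂ) (G : Set ℂ) : ℕ := numZeros (ratDeriv f) G

/-- The rational approximate Gauss--Lucas property of `K`: every rational function with `n` zeros
and poles combined, at least `k` of its zeros in `K`, has at least `k - 1` critical points in the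
`ε`-neighborhood `{z | dist(z, K) < ε}` of `K`. -/
def RAGL (K : Set ℂ) (n k : ℕ) (ε : ℝ) : Prop :=
  ∀ f : RatFunc ℂ, f ≠ 0 →
    numZeros f Set.univ + numPoles f Set.univ = n →
    k ≤ numZeros f K →
    k - 1 ≤ numCrit f (Metric.thickening ε K)

end GaussLucas

end

namespace GaussLucas

open Polynomial Filter Topology

/-! Write f = u / v in lowest terms and u = p * a, with the roots of p in K and those of a outside.
Then u'v - uv' = p'av + p(a'v - av'). On a level set dist(z, K) = δ, convexity of K gives a lower
bound for |p'/p| (`card_mul_le_norm_sum_one_div`), proportional to the at least k roots of p. The at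
most n - k roots of a and v make a'/a - v'/v small once the level set avoids them, and some δ in
[ε/2, ε) achieves this (`exists_level_far`). By Rouché (`rootCount_add_eq`), u'v - uv' has as many
roots in the δ-neighborhood as p'av: at least k - 1 from p' by Gauss–Lucas, plus those of v. Poles
account for no more than the latter (`rootCount_wronskian_le`), leaving k - 1 critical points. -/

/-- The roots of `p` lying in `G`, counted with multiplicity. -/
noncomputable def rootCount (p : ℂ[X]) (G : Set ℂ) : ℕ :=
  open Classical in p.roots.countP (· ∈ G)

/-! ### Root counts under limits and homotopies: Hurwitz and Rouché. -/

theorem norm_prod_sub_le {x z : ℂ} {ρ : ℝ} (hρ : 0 < ρ) (s : Multiset ℂ)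
    (hs : ∀ y ∈ s, ρ ≤ ‖x - y‖) :
    ‖(s.map (z - ·)).prod‖ ≤ ‖(s.map (x - ·)).prod‖ * (1 + ‖z - x‖ / ρ) ^ s.card := by
  induction s using Multiset.induction with
  | empty => simp
  | cons a s ih =>
    have ha := hs a (by simp)
    have ih := ih fun y hy => hs y (by simp [hy])
    simp only [Multiset.map_cons, Multiset.prod_cons, norm_mul, Multiset.card_cons, pow_succ]
    have h1 : ‖z - a‖ ≤ ‖x - a‖ * (1 + ‖z - x‖ / ρ) := by
      have h2 : ‖z - a‖ ≤ ‖z - x‖ + ‖x - a‖ := by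
        simpa using norm_add_le (z - x) (x - a)
      have h3 : ρ * (‖z - x‖ / ρ) = ‖z - x‖ := by field_simp
      have h4 : ρ * (‖z - x‖ / ρ) ≤ ‖x - a‖ * (‖z - x‖ / ρ) := by gcongr
      linarith
    calc _ ≤ (‖x - a‖ * (1 + ‖z - x‖ / ρ)) *
          (‖(s.map (x - ·)).prod‖ * (1 + ‖z - x‖ / ρ) ^ s.card) := by gcongr
      _ = _ := by ring

theorem norm_eval_le_of_roots_far {x z : ℂ} {ρ : ℝ} (hρ : 0 < ρ) {p : ℂ[X]} {D : ℕ}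
    (hD : p.natDegree ≤ D) (hp : ∀ y ∈ p.roots, ρ ≤ ‖x - y‖) :
    ‖p.eval z‖ ≤ ‖p.eval x‖ * (1 + ‖z - x‖ / ρ) ^ D := by
  have h1 : 1 ≤ 1 + ‖z - x‖ / ρ := by
    have : 0 ≤ ‖z - x‖ / ρ := by positivity
    linarith
  have hs := IsAlgClosed.splits p
  calc ‖p.eval z‖ = ‖p.leadingCoeff‖ * ‖(p.roots.map (z - ·)).prod‖ := by
        rw [hs.eval_eq_prod_roots, norm_mul]
    _ ≤ ‖p.leadingCoeff‖ * (‖(p.roots.map (x - ·)).prod‖ *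
          (1 + ‖z - x‖ / ρ) ^ p.roots.card) := by
        gcongr; exact norm_prod_sub_le hρ _ hp
    _ = ‖p.eval x‖ * (1 + ‖z - x‖ / ρ) ^ p.roots.card := by
        rw [hs.eval_eq_prod_roots x, norm_mul, mul_assoc]
    _ ≤ _ := by
        gcongr
        exact p.card_roots'.trans hD

theorem tendsto_eval_of_tendsto_coeff {H : ℕ → ℂ[X]} {P : ℂ[X]} {D : ℕ}
    (hD : ∀ i, (H i).natDegree ≤ D) (hP : P.natDegree ≤ D)
    (hc : ∀ j, Tendsto (fun i => (H i).coeff j) atTop (𝓝 (P.coeff j)))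
    {x : ℕ → ℂ} {y : ℂ} (hx : Tendsto x atTop (𝓝 y)) :
    Tendsto (fun i => (H i).eval (x i)) atTop (𝓝 (P.eval y)) := by
  rw [eval_eq_sum_range' (Nat.lt_succ_of_le hP)]
  simp_rw [fun i => eval_eq_sum_range' (Nat.lt_succ_of_le (hD i)) (x i)]
  exact tendsto_finsetSum _ fun j _ => (hc j).mul (hx.pow j)

theorem tendsto_coeff_divByMonic {H : ℕ → ℂ[X]} {P : ℂ[X]} {D : ℕ}
    (hD : ∀ i, (H i).natDegree ≤ D) (hP : P.natDegree ≤ D)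
    (hc : ∀ j, Tendsto (fun i => (H i).coeff j) atTop (𝓝 (P.coeff j)))
    {x : ℕ → ℂ} {y : ℂ} (hx : Tendsto x atTop (𝓝 y)) (j : ℕ) :
    Tendsto (fun i => (H i /ₘ (X - C (x i))).coeff j) atTop
      (𝓝 ((P /ₘ (X - C y)).coeff j)) := by
  -- Synthetic division: each coefficient of the quotient is a fixed polynomial in a and the
  -- coefficients of p, hence continuous.
  have key : ∀ (p : ℂ[X]) (a : ℂ), p.natDegree ≤ D → (p /ₘ (X - C a)).coeff j =
      ∑ i ∈ Finset.Icc (j + 1) D, a ^ (i - (j + 1)) * p.coeff i := by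
    intro p a hp
    rw [coeff_divByMonic_X_sub_C]
    refine Finset.sum_subset (Finset.Icc_subset_Icc_right hp) fun i hi hi' => ?_
    rw [coeff_eq_zero_of_natDegree_lt, mul_zero]
    simp only [Finset.mem_Icc] at hi hi'
    omega
  rw [key P y hP]
  simp_rw [fun i => key (H i) (x i) (hD i)]
  exact tendsto_finsetSum _ fun i _ => (hx.pow _).mul (hc i)

/-- With roots staying ρ away from x, |H i (z)| is at most a constant independent of i times |H i
(x)|, which tends to 0. This is the base case of Hurwitz. -/
theorem eq_zero_of_tendsto_of_roots_far {H : ℕ → ℂ[X]} {P : ℂ[X]} {D : ℕ}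
    (hD : ∀ i, (H i).natDegree ≤ D) (hP : P.natDegree ≤ D)
    (hc : ∀ j, Tendsto (fun i => (H i).coeff j) atTop (𝓝 (P.coeff j)))
    {x : ℂ} {ρ : ℝ} (hρ : 0 < ρ) (hx : P.eval x = 0)
    (hfar : ∀ i, ∀ y ∈ (H i).roots, ρ ≤ ‖x - y‖) : P = 0 := by
  refine Polynomial.funext fun z => ?_
  rw [eval_zero, ← norm_le_zero_iff]
  have h1 := (tendsto_eval_of_tendsto_coeff hD hP hc (tendsto_const_nhds (x := z))).norm
  have h2 := (tendsto_eval_of_tendsto_coeff hD hP hc (tendsto_const_nhds (x := x))).norm.mul_const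
    ((1 + ‖z - x‖ / ρ) ^ D)
  rw [hx, norm_zero, zero_mul] at h2
  exact le_of_tendsto_of_tendsto' h1 h2 fun i => norm_eval_le_of_roots_far hρ (hD i) (hfar i)

theorem rootCount_eq_zero_iff {p : ℂ[X]} {U : Set ℂ} :
    rootCount p U = 0 ↔ ∀ x ∈ p.roots, x ∉ U := by
  classical
  rw [rootCount, Multiset.countP_eq_zero]

theorem rootCount_eq_divByMonic_add_one {p : ℂ[X]} {U : Set ℂ} (hp : p ≠ 0) {x : ℂ} (hxU : x ∈ U)
    (hx : p.eval x = 0) : rootCount p U = rootCount (p /ₘ (X - C x)) U + 1 := by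
  classical
  have h := mul_divByMonic_eq_iff_isRoot.2 (show p.IsRoot x from hx)
  have h0 : (X - C x) * (p /ₘ (X - C x)) ≠ 0 := by rwa [h]
  unfold rootCount
  conv_lhs => rw [← h, roots_mul h0, roots_X_sub_C, Multiset.singleton_add,
    Multiset.countP_cons_of_pos _ hxU]

/-- Hurwitz: the number of roots in a bounded open set passes to coefficientwise limits of
polynomials of bounded degree, if the limit has no roots on the frontier. -/
theorem rootCount_eq_of_tendsto {U : Set ℂ} (hU : IsOpen U) (hb : Bornology.IsBounded U) {D : ℕ}
    (d : ℕ) {H : ℕ → ℂ[X]} {P : ℂ[X]}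
    (hD : ∀ i, (H i).natDegree ≤ D) (hP : P.natDegree ≤ D)
    (hc : ∀ j, Tendsto (fun i => (H i).coeff j) atTop (𝓝 (P.coeff j)))
    (hP0 : P ≠ 0) (hfr : ∀ z ∈ frontier U, P.eval z ≠ 0)
    (hd : ∀ i, rootCount (H i) U = d) : rootCount P U = d := by
  induction d generalizing H P with
  | zero =>
    rw [rootCount_eq_zero_iff]
    intro x hx hxU
    obtain ⟨ρ, hρ, hball⟩ := Metric.isOpen_iff.1 hU x hxU
    refine hP0 (eq_zero_of_tendsto_of_roots_far hD hP hc hρ (isRoot_of_mem_roots hx) ?_)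
    intro i y hy
    by_contra! hlt
    refine rootCount_eq_zero_iff.1 (hd i) y hy (hball ?_)
    rwa [Metric.mem_ball, dist_comm, dist_eq_norm]
  | succ d ih =>
    have hex : ∀ i, ∃ x ∈ (H i).roots, x ∈ U := by
      intro i
      by_contra! h
      have := rootCount_eq_zero_iff.2 h
      rw [hd i] at this
      omega
    choose x hxr hxU using hex
    -- A subsequence of roots converges to a root of P, inside U because P has none on the frontier;
    -- dividing these roots out lowers the count by one.
    obtain ⟨y, hy, φ, hφ, hlim⟩ := tendsto_subseq_of_bounded hb hxU
    have hc' : ∀ j, Tendsto (fun i => (H (φ i)).coeff j) atTop (𝓝 (P.coeff j)) :=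
      fun j => (hc j).comp hφ.tendsto_atTop
    have hPy : P.eval y = 0 := by
      have h1 := tendsto_eval_of_tendsto_coeff (fun i => hD (φ i)) hP hc' hlim
      refine tendsto_nhds_unique h1 ?_
      have h2 : ∀ i, (H (φ i)).eval ((x ∘ φ) i) = 0 := fun i => isRoot_of_mem_roots (hxr (φ i))
      simp only [h2]
      exact tendsto_const_nhds
    have hyU : y ∈ U := by
      by_contra hyU
      exact hfr y ⟨hy, by rwa [hU.interior_eq]⟩ hPy
    have hmul := mul_divByMonic_eq_iff_isRoot.2 (show P.IsRoot y from hPy)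
    have hdeg : ∀ (p : ℂ[X]) (a : ℂ), p.natDegree ≤ D → (p /ₘ (X - C a)).natDegree ≤ D := by
      intro p a hp
      rw [natDegree_divByMonic _ (monic_X_sub_C a)]
      omega
    rw [rootCount_eq_divByMonic_add_one hP0 hyU hPy]
    congr 1
    refine ih (H := fun i => H (φ i) /ₘ (X - C (x (φ i)))) (fun i => hdeg _ _ (hD _)) (hdeg _ _ hP)
      (tendsto_coeff_divByMonic (fun i => hD (φ i)) hP hc' hlim) ?_ ?_ ?_
    · intro h0
      rw [h0, mul_zero] at hmul
      exact hP0 hmul.symm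
    · intro z hz h0
      refine hfr z hz ?_
      rw [← hmul, eval_mul, h0, mul_zero]
    · intro i
      have h1 := rootCount_eq_divByMonic_add_one (ne_zero_of_mem_roots (hxr (φ i))) (hxU (φ i))
        (isRoot_of_mem_roots (hxr (φ i)))
      have h2 := hd (φ i)
      omega

/-- Rouché's theorem for polynomials on a bounded open set. -/
theorem rootCount_add_eq {U : Set ℂ} (hU : IsOpen U) (hb : Bornology.IsBounded U)
    (hne : U.Nonempty) {F G : ℂ[X]}
    (hlt : ∀ z ∈ frontier U, ‖G.eval z‖ < ‖F.eval z‖) :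
    rootCount (F + G) U = rootCount F U := by
  set D := max F.natDegree G.natDegree
  let H : unitInterval → ℂ[X] := fun t => F + C ((t : ℝ) : ℂ) * G
  have hD : ∀ t, (H t).natDegree ≤ D := fun t =>
    (natDegree_add_le _ _).trans (max_le_max le_rfl (natDegree_C_mul_le _ _))
  have hfr : ∀ t, ∀ z ∈ frontier U, (H t).eval z ≠ 0 := by
    intro t z hz h
    have h1 : F.eval z = -(((t : ℝ) : ℂ) * G.eval z) := by
      simp only [H, eval_add, eval_mul, eval_C] at h
      exact eq_neg_of_add_eq_zero_left h
    have h2 : ‖F.eval z‖ ≤ ‖G.eval z‖ := by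
      rw [h1, norm_neg, norm_mul, Complex.norm_real, Real.norm_of_nonneg t.2.1]
      exact mul_le_of_le_one_left (norm_nonneg _) t.2.2
    exact (hlt z hz).not_ge h2
  -- A frontier point rules out H t = 0, as Hurwitz needs a nonzero limit.
  obtain ⟨z₀, hz₀⟩ : (frontier U).Nonempty := by
    refine nonempty_frontier_iff.2 ⟨hne, ?_⟩
    rintro rfl
    exact NormedSpace.unbounded_univ ℝ ℂ hb
  have h0 : ∀ t, H t ≠ 0 := fun t h => hfr t z₀ hz₀ (by rw [h, eval_zero])
  -- Finitely many closed level sets cover [0, 1], so the count is continuous in t, hence constant.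
  have hclosed : ∀ d, IsClosed {t | rootCount (H t) U = d} := by
    intro d
    refine IsSeqClosed.isClosed fun u t hu ht => ?_
    refine rootCount_eq_of_tendsto hU hb d (fun i => hD (u i)) (hD t) (fun j => ?_) (h0 t) (hfr t) hu
    simp only [H, coeff_add, coeff_C_mul]
    have h1 : Tendsto (fun i => ((u i : ℝ) : ℂ)) atTop (𝓝 ((t : ℝ) : ℂ)) :=
      ((Complex.continuous_ofReal.comp continuous_subtype_val).tendsto t).comp ht
    exact tendsto_const_nhds.add (h1.mul_const _)
  have hle : ∀ t, rootCount (H t) U ≤ D := fun t => by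
    classical
    exact (Multiset.countP_le_card _ _).trans ((card_roots' _).trans (hD t))
  have hcont : Continuous fun t => rootCount (H t) U := by
    refine continuous_iff_isClosed.2 fun s _ => ?_
    have : (fun t => rootCount (H t) U) ⁻¹' s =
        ⋃ d ∈ s ∩ Set.Iic D, {t | rootCount (H t) U = d} := by
      ext t
      simp [hle t]
    rw [this]
    exact ((Set.finite_Iic D).inter_of_right s).isClosed_biUnion fun d _ => hclosed d
  have := PreconnectedSpace.constant (inferInstance : PreconnectedSpace unitInterval) hcont
    (x := 1) (y := 0)
  simpa [H] using this

theorem rootCount_mono (p : ℂ[X]) {U V : Set ℂ} (h : U ⊆ V) : rootCount p U ≤ rootCount p V := by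
  classical
  unfold rootCount
  rw [Multiset.countP_eq_card_filter, Multiset.countP_eq_card_filter]
  exact Multiset.card_le_card (Multiset.monotone_filter_right _ fun x hx => h hx)

theorem rootCount_mul {p q : ℂ[X]} (h : p * q ≠ 0) (U : Set ℂ) :
    rootCount (p * q) U = rootCount p U + rootCount q U := by
  classical
  rw [rootCount, roots_mul h, Multiset.countP_add]
  rfl

/-! ### Choice of the level set and bounds on logarithmic derivatives. -/

/-- Pigeonhole: with r = ε / (8m), the m + 1 levels ε/2 + 2ri, i ≤ m, are 2r apart and at most 3ε/4,
and each d lies within r of at most one. -/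
theorem exists_level_far {ε : ℝ} (hε : 0 < ε) {m : ℕ} (hm : 0 < m) (s : Finset ℝ)
    (hs : s.card ≤ m) :
    ∃ δ, ε / 2 ≤ δ ∧ δ < ε ∧ ∀ d ∈ s, ε / (8 * m) ≤ |δ - d| := by
  have hm' : (0 : ℝ) < m := by exact_mod_cast hm
  set r := ε / (8 * m) with hr
  have hr0 : 0 < r := by positivity
  have hrm : r * m = ε / 8 := by rw [hr]; field_simp
  by_contra! hcon
  have hex : ∀ i : Fin (m + 1), ∃ d ∈ s, |ε / 2 + 2 * r * (i : ℕ) - d| < r := by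
    intro i
    have hi : ((i : ℕ) : ℝ) ≤ m := by exact_mod_cast Nat.le_of_lt_succ i.2
    refine hcon _ ?_ ?_
    · have : 0 ≤ 2 * r * ((i : ℕ) : ℝ) := by positivity
      linarith
    · have : r * ((i : ℕ) : ℝ) ≤ r * m := by gcongr
      linarith
  choose d hds hd using hex
  have hinj : Function.Injective d := by
    have key : ∀ i j, d i = d j → (i : ℕ) ≤ (j : ℕ) := by
      intro i j hij
      by_contra! hlt
      have h1 : ((j : ℕ) : ℝ) + 1 ≤ ((i : ℕ) : ℝ) := by exact_mod_cast hlt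
      have h2 : r * (((j : ℕ) : ℝ) + 1) ≤ r * ((i : ℕ) : ℝ) := by gcongr
      have h3 := abs_lt.1 (hd i)
      have h4 := abs_lt.1 (hd j)
      rw [hij] at h3
      linarith [h3.2, h4.1]
    exact fun i j hij => Fin.ext (le_antisymm (key i j hij) (key j i hij.symm))
  have := Finset.card_le_card_of_injOn d (s := Finset.univ) (fun i _ => hds i) hinj.injOn
  rw [Finset.card_univ, Fintype.card_fin] at this
  omega

theorem norm_sum_one_div_le {z : ℂ} {r : ℝ} (hr : 0 < r) (s : Multiset ℂ)
    (hs : ∀ w ∈ s, r ≤ ‖z - w‖) : ‖(s.map fun w => 1 / (z - w)).sum‖ ≤ s.card / r := by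
  induction s using Multiset.induction with
  | empty => simp
  | cons a s ih =>
    rw [Multiset.map_cons, Multiset.sum_cons, Multiset.card_cons]
    have h1 : ‖1 / (z - a)‖ ≤ 1 / r := by
      rw [norm_div, norm_one]
      exact one_div_le_one_div_of_le hr (hs a (by simp))
    have h2 := ih fun w hw => hs w (by simp [hw])
    have h3 := norm_add_le (1 / (z - a)) (s.map fun w => 1 / (z - w)).sum
    push_cast
    rw [add_div]
    linarith

/-- If y is the point of the closure of K nearest z, then K lies in the half-plane ⟨z - y, w - y⟩ ≤
0. So every (z - y)/(z - w) has real part at least δ²/(diam K + δ)², and the terms cannot cancel. -/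
theorem card_mul_le_norm_sum_one_div {K : Set ℂ} (hK : Bornology.IsBounded K)
    (hconv : Convex ℝ K) (hne : K.Nonempty) {z : ℂ} {δ : ℝ} (hδ : 0 < δ)
    (hz : Metric.infDist z K = δ) (s : Multiset ℂ) (hs : ∀ w ∈ s, w ∈ K) :
    s.card * (δ / (Metric.diam K + δ) ^ 2) ≤ ‖(s.map fun w => 1 / (z - w)).sum‖ := by
  obtain ⟨y, hy, hdy⟩ := isClosed_closure.exists_infDist_eq_dist hne.closure z
  rw [Metric.infDist_closure, hz, dist_eq_norm] at hdy
  have hinf : ‖z - y‖ = ⨅ w : closure K, ‖z - w‖ := by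
    rw [← hdy, ← hz, ← Metric.infDist_closure, Metric.infDist_eq_iInf]
    simp only [dist_eq_norm]
  have hin := (norm_eq_iInf_iff_real_inner_le_zero hconv.closure hy).1 hinf
  have hterm : ∀ w ∈ K, δ ^ 2 / (Metric.diam K + δ) ^ 2 ≤ ((z - y) * (1 / (z - w))).re := by
    intro w hw
    have h1 := hin w (subset_closure hw)
    have h2 : inner ℝ (z - y) (z - w) = δ ^ 2 - inner ℝ (z - y) (w - y) := by
      rw [hdy, ← real_inner_self_eq_norm_sq, ← inner_sub_right]
      congr 1
      ring
    have h3 : ((z - y) * (1 / (z - w))).re = inner ℝ (z - y) (z - w) / ‖z - w‖ ^ 2 := by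
      rw [Complex.inner, one_div, Complex.inv_def, Complex.normSq_eq_norm_sq,
        ← mul_assoc, Complex.re_mul_ofReal, div_eq_mul_inv]
      congr 1
      simp only [Complex.mul_re, Complex.conj_re, Complex.conj_im]
      ring
    have h4 : ‖z - w‖ ≤ Metric.diam K + δ := by
      have h5 : dist y w ≤ Metric.diam K := by
        rw [← Metric.diam_closure]
        exact Metric.dist_le_diam_of_mem hK.closure hy (subset_closure hw)
      have h6 := dist_triangle z y w
      rw [dist_eq_norm z w, dist_eq_norm z y, ← hdy] at h6
      linarith
    have h7 : 0 < ‖z - w‖ := by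
      have := Metric.infDist_le_dist_of_mem (x := z) hw
      rw [hz, dist_eq_norm] at this
      linarith
    rw [h3, h2]
    exact div_le_div₀ (by linarith [sq_nonneg δ]) (by linarith) (by positivity) (by gcongr)
  have hre : s.card * (δ ^ 2 / (Metric.diam K + δ) ^ 2) ≤
      ((z - y) * (s.map fun w => 1 / (z - w)).sum).re := by
    induction s using Multiset.induction with
    | empty => simp
    | cons a s ih =>
      rw [Multiset.map_cons, Multiset.sum_cons, Multiset.card_cons, mul_add, Complex.add_re]
      have h1 := hterm a (hs a (by simp))
      have h2 := ih fun w hw => hs w (by simp [hw])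
      push_cast
      linarith
  have h1 := hre.trans (Complex.re_le_norm _)
  rw [norm_mul, ← hdy] at h1
  refine le_of_mul_le_mul_left ?_ hδ
  calc _ = s.card * (δ ^ 2 / (Metric.diam K + δ) ^ 2) := by ring
    _ ≤ _ := h1

/-! ### Gauss–Lucas, critical points against poles, and the Rouché inequality. -/

theorem roots_derivative_mem {K : Set ℂ} (hconv : Convex ℝ K) {p : ℂ[X]}
    (hp : ∀ x ∈ p.roots, x ∈ K) : ∀ x ∈ p.derivative.roots, x ∈ K := by
  intro x hx
  have hp' := ne_zero_of_mem_roots hx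
  have hp0 : p ≠ 0 := by rintro rfl; simp at hp'
  have hdeg : 0 < p.degree := by
    rw [← natDegree_pos_iff_degree_pos]
    by_contra! h
    exact hp' (derivative_of_natDegree_zero (by omega))
  refine convexHull_min (fun y hy => hp y ?_) hconv
    (rootSet_derivative_subset_convexHull_rootSet hdeg
      (mem_rootSet.2 ⟨hp', by simpa using isRoot_of_mem_roots hx⟩))
  rw [mem_rootSet, coe_aeval_eq_eval] at hy
  exact (mem_roots hp0).2 hy.2

theorem card_roots_sub_one_le_rootCount_derivative {K U : Set ℂ} (hconv : Convex ℝ K)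
    (hKU : K ⊆ U) {p : ℂ[X]} (hp : ∀ x ∈ p.roots, x ∈ K) :
    p.roots.card - 1 ≤ rootCount p.derivative U := by
  classical
  rw [rootCount, Multiset.countP_eq_card.2 fun x hx => hKU (roots_derivative_mem hconv hp x hx),
    ← (IsAlgClosed.splits p.derivative).natDegree_eq_card_roots,
    ← (IsAlgClosed.splits p).natDegree_eq_card_roots, natDegree_derivative]

/-- The critical points of `f` are, up to the poles of `f`, the roots of `u' v - u v'`
where `f = u / v` in lowest terms. -/
theorem rootCount_wronskian_le (f : RatFunc ℂ) (U : Set ℂ) :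
    rootCount (derivative f.num * f.denom - f.num * derivative f.denom) U ≤
      numCrit f U + rootCount f.denom U := by
  classical
  set N := derivative f.num * f.denom - f.num * derivative f.denom with hN
  have hv : f.denom ≠ 0 := f.denom_ne_zero
  suffices h : N.roots ≤ (ratDeriv f).num.roots + f.denom.roots by
    unfold rootCount numCrit numZeros
    rw [← Multiset.countP_add]
    exact Multiset.countP_le_of_le _ h
  rcases eq_or_ne N 0 with h0 | h0
  · simp [h0]
  have hmul : (ratDeriv f).num * f.denom ^ 2 = N * (ratDeriv f).denom :=
    (RatFunc.num_mul_eq_mul_denom_iff (pow_ne_zero 2 hv)).2 rfl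
  have hd : (ratDeriv f).denom ≠ 0 := (ratDeriv f).denom_ne_zero
  have hmul0 : N * (ratDeriv f).denom ≠ 0 := mul_ne_zero h0 hd
  have hroots : (ratDeriv f).num.roots + 2 • f.denom.roots = N.roots + (ratDeriv f).denom.roots := by
    rw [← roots_pow, ← roots_mul (by rwa [hmul]), hmul, roots_mul hmul0]
  rw [Multiset.le_iff_count]
  intro x
  have hx := congrArg (Multiset.count x) hroots
  simp only [Multiset.count_add, Multiset.count_nsmul] at hx ⊢
  by_cases hxv : f.denom.IsRoot x
  -- At a pole of order μ, v' vanishes to order exactly μ - 1 and u does not vanish, so N cannot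
  -- vanish to order above μ.
  · have hxu : ¬ f.num.IsRoot x := by
      intro hxu
      obtain ⟨a, b, hab⟩ := f.isCoprime_num_denom
      have := congrArg (eval x) hab
      simp [IsRoot.def.1 hxu, IsRoot.def.1 hxv] at this
    suffices N.roots.count x ≤ f.denom.roots.count x by omega
    rw [count_roots, count_roots]
    by_contra! hlt
    have hdvN : (X - C x) ^ f.denom.rootMultiplicity x ∣ N :=
      (pow_dvd_pow _ hlt.le).trans (pow_rootMultiplicity_dvd N x)
    have hdv2 : (X - C x) ^ f.denom.rootMultiplicity x ∣ f.num * derivative f.denom := by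
      have h1 : f.num * derivative f.denom = derivative f.num * f.denom - N := by rw [hN]; ring
      rw [h1]
      exact dvd_sub (Dvd.dvd.mul_left (pow_rootMultiplicity_dvd _ _) _) hdvN
    have hcop : IsCoprime ((X - C x) ^ f.denom.rootMultiplicity x) f.num :=
      ((irreducible_X_sub_C x).coprime_iff_not_dvd.2 fun h => hxu (dvd_iff_isRoot.1 h)).pow_left
    have hdv3 := hcop.dvd_of_dvd_mul_left hdv2
    have hv' : derivative f.denom ≠ 0 := by
      intro h
      have h1 := derivative_eq_zero.1 h
      rw [natDegree_eq_zero_iff_degree_le_zero] at h1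
      exact hv (by
        rw [eq_C_of_degree_le_zero h1] at hxv ⊢
        simpa using hxv)
    have h2 := (le_rootMultiplicity_iff hv').2 hdv3
    rw [derivative_rootMultiplicity_of_root hxv] at h2
    have h3 := (rootMultiplicity_pos hv).2 hxv
    omega
  · have : f.denom.roots.count x = 0 := Multiset.count_eq_zero.2 fun h => hxv (isRoot_of_mem_roots h)
    omega

/-- If all roots of `p` are in the convex set `K` and `a`, `b` have few roots, far from `z`, then
the logarithmic derivative of `p` dominates that of `a / b` at `z`. -/
theorem norm_eval_lt_of_far {K : Set ℂ} (hK : Bornology.IsBounded K) (hconv : Convex ℝ K)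
    (hne : K.Nonempty) {p a b : ℂ[X]} (hp0 : p ≠ 0) (ha0 : a ≠ 0) (hb0 : b ≠ 0)
    (hp : ∀ x ∈ p.roots, x ∈ K) {z : ℂ} {δ r : ℝ} (hδ : 0 < δ) (hr : 0 < r)
    (hz : Metric.infDist z K = δ)
    (ha : ∀ w ∈ a.roots, r ≤ ‖z - w‖) (hb : ∀ w ∈ b.roots, r ≤ ‖z - w‖)
    (hlt : ((a.roots.card : ℝ) + b.roots.card) / r <
      p.roots.card * (δ / (Metric.diam K + δ) ^ 2)) :
    ‖(p * (derivative a * b - a * derivative b)).eval z‖ < ‖(derivative p * a * b).eval z‖ := by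
  have hne_of : ∀ q : ℂ[X], q ≠ 0 → (∀ w ∈ q.roots, r ≤ ‖z - w‖) → q.eval z ≠ 0 := by
    intro q hq hfar h
    have := hfar z ((mem_roots hq).2 h)
    rw [sub_self, norm_zero] at this
    linarith
  have hza := hne_of a ha0 ha
  have hzb := hne_of b hb0 hb
  have hzp : p.eval z ≠ 0 := by
    intro h
    rw [Metric.infDist_zero_of_mem (hp z ((mem_roots hp0).2 h))] at hz
    linarith
  have h1 := card_mul_le_norm_sum_one_div hK hconv hne hδ hz _ hp
  have h2 := norm_sum_one_div_le hr _ ha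
  have h3 := norm_sum_one_div_le hr _ hb
  rw [← (IsAlgClosed.splits _).eval_derivative_div_eval_of_ne_zero hzp] at h1
  rw [← (IsAlgClosed.splits _).eval_derivative_div_eval_of_ne_zero hza] at h2
  rw [← (IsAlgClosed.splits _).eval_derivative_div_eval_of_ne_zero hzb] at h3
  have h4 : ‖(derivative a).eval z / a.eval z - (derivative b).eval z / b.eval z‖ <
      ‖(derivative p).eval z / p.eval z‖ := by
    refine (norm_sub_le _ _).trans_lt (lt_of_le_of_lt ?_ (hlt.trans_le h1))
    rw [add_div]
    exact add_le_add h2 h3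
  have hpos : 0 < ‖p.eval z * a.eval z * b.eval z‖ := norm_pos_iff.2 (by positivity)
  have h5 := mul_lt_mul_of_pos_left h4 hpos
  rw [← norm_mul, ← norm_mul] at h5
  have h6 : (p * (derivative a * b - a * derivative b)).eval z = p.eval z * a.eval z * b.eval z *
      ((derivative a).eval z / a.eval z - (derivative b).eval z / b.eval z) := by
    simp only [eval_mul, eval_sub]
    field_simp
  have h7 : (derivative p * a * b).eval z = p.eval z * a.eval z * b.eval z *
      ((derivative p).eval z / p.eval z) := by
    simp only [eval_mul]
    field_simp
  rwa [h6, h7]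

/-! ### The constants and the conclusion. -/

/-- Bounding δ below by ε/2 and s + δ above by s + ε leaves 8m²/ε < kε / (2(s + ε)²), that is 4m(s +
ε) < ε√k, which is the hypothesis on ε. -/
theorem ragl_bound {s ε m k : ℝ} (hs : 0 ≤ s) (hm : 0 < m) (hk : 0 ≤ k) (hkm : 4 * m < √k)
    (hε : 4 * s * m / (√k - 4 * m) < ε) {δ : ℝ} (h1 : ε / 2 ≤ δ) (h2 : δ < ε) :
    m / (ε / (8 * m)) < k * (δ / (s + δ) ^ 2) := by
  have hpos : 0 < √k - 4 * m := by linarith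
  have hε0 : 0 < ε := lt_of_le_of_lt (by positivity) hε
  have h3 : 4 * m * (s + ε) < ε * √k := by
    rw [div_lt_iff₀ hpos] at hε
    linarith
  have h4 : (4 * m * (s + ε)) ^ 2 < ε ^ 2 * k := by
    calc _ < (ε * √k) ^ 2 := by gcongr
      _ = _ := by rw [mul_pow, Real.sq_sqrt hk]
  have h5 : k * ((ε / 2) / (s + ε) ^ 2) ≤ k * (δ / (s + δ) ^ 2) := by
    have : 0 < δ := by linarith
    gcongr
  refine lt_of_lt_of_le ?_ h5
  rw [div_div_eq_mul_div, div_lt_iff₀ hε0, mul_div_assoc', div_mul_eq_mul_div,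
    lt_div_iff₀ (by positivity)]
  linarith

theorem ragl_of_convex (K : Set ℂ) (hK : Bornology.IsBounded K) (hconv : Convex ℝ K)
    (n k : ℕ) (hk : 0 < k) (hkn : k < n)
    (hsqrt : 4 * ((n : ℝ) - (k : ℝ)) < Real.sqrt (k : ℝ))
    (ε : ℝ)
    (hε : 4 * Metric.diam K * ((n : ℝ) - (k : ℝ)) /
      (Real.sqrt (k : ℝ) - 4 * ((n : ℝ) - (k : ℝ))) < ε) :
    RAGL K n k ε := by
  classical
  intro f hf htot hkK
  obtain ⟨m, rfl⟩ := Nat.exists_eq_add_of_lt hkn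
  set M := m + 1 with hM
  have hnk : ((k + m + 1 : ℕ) : ℝ) - (k : ℝ) = M := by rw [hM]; push_cast; ring
  rw [hnk] at hsqrt hε
  have hM0 : (0 : ℝ) < M := by rw [hM]; positivity
  have hε0 : 0 < ε := lt_of_le_of_lt
    (div_nonneg (by have := Metric.diam_nonneg (s := K); positivity) (by linarith)) hε
  set u := f.num with hu
  set v := f.denom with hv
  have hu0 : u ≠ 0 := RatFunc.num_ne_zero hf
  have hv0 : v ≠ 0 := f.denom_ne_zero
  set ZK := u.roots.filter (· ∈ K) with hZK
  set ZA := u.roots.filter (· ∉ K) with hZA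
  set p : ℂ[X] := (ZK.map fun x => X - C x).prod with hp
  set a : ℂ[X] := C u.leadingCoeff * (ZA.map fun x => X - C x).prod with ha
  have hlc : u.leadingCoeff ≠ 0 := leadingCoeff_ne_zero.2 hu0
  have hpr : p.roots = ZK := roots_multiset_prod_X_sub_C _
  have har : a.roots = ZA := by rw [ha, roots_C_mul _ hlc, roots_multiset_prod_X_sub_C]
  have hpK : ∀ x ∈ p.roots, x ∈ K := fun x hx => by
    rw [hpr] at hx
    exact (Multiset.mem_filter.1 hx).2
  have hupa : u = p * a := by
    conv_lhs => rw [(IsAlgClosed.splits u).eq_prod_roots, ← Multiset.filter_add_not (· ∈ K) u.roots,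
      Multiset.map_add, Multiset.prod_add]
    rw [hp, ha, hZK, hZA]
    ring
  have hp0 : p ≠ 0 := left_ne_zero_of_mul (hupa ▸ hu0)
  have ha0 : a ≠ 0 := right_ne_zero_of_mul (hupa ▸ hu0)
  have hcardK : k ≤ p.roots.card := by
    rw [hpr, hZK, ← Multiset.countP_eq_card_filter]
    exact hkK
  have hcard : p.roots.card + a.roots.card + v.roots.card = k + m + 1 := by
    rw [← htot, hpr, har, hZK, hZA, ← Multiset.card_add, Multiset.filter_add_not]
    simp [numZeros, numPoles, hu, hv]
  obtain ⟨w₀, hw₀⟩ : ∃ x, x ∈ p.roots := Multiset.card_pos_iff_exists_mem.1 (hk.trans_le hcardK)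
  have hne : K.Nonempty := ⟨w₀, hpK w₀ hw₀⟩
  obtain ⟨δ, hδ1, hδ2, hδ⟩ := exists_level_far hε0 (Nat.succ_pos m)
    ((a.roots + v.roots).toFinset.image fun w => Metric.infDist w K)
    (Finset.card_image_le.trans ((Multiset.toFinset_card_le _).trans
      (by rw [Multiset.card_add]; omega)))
  set r := ε / (8 * (M : ℝ)) with hr
  have hr0 : 0 < r := by positivity
  have hδ0 : 0 < δ := by linarith
  set U := Metric.thickening δ K with hU
  have hfar : ∀ z, Metric.infDist z K = δ → ∀ w ∈ a.roots + v.roots, r ≤ ‖z - w‖ := by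
    intro z hz w hw
    have h1 := hδ _ (Finset.mem_image_of_mem _ (Multiset.mem_toFinset.2 hw))
    refine h1.trans ?_
    -- The distance to K is 1-Lipschitz, so a gap between levels is a gap between points.
    rw [← hz, ← dist_eq_norm, ← Real.dist_eq]
    simpa using (Metric.lipschitz_infDist_pt K).dist_le_mul z w
  have hrouche : ∀ z ∈ frontier U, ‖(p * (derivative a * v - a * derivative v)).eval z‖ <
      ‖(derivative p * a * v).eval z‖ := by
    intro z hz
    have hzδ : Metric.infDist z K = δ := by
      have := Metric.frontier_thickening_subset K hz
      rw [Metric.infDist, this, ENNReal.toReal_ofReal hδ0.le]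
    refine norm_eval_lt_of_far hK hconv hne hp0 ha0 hv0 hpK hδ0 hr0 hzδ
      (fun w hw => hfar z hzδ w (by simp only [Multiset.mem_add]; exact Or.inl hw))
      (fun w hw => hfar z hzδ w (by simp only [Multiset.mem_add]; exact Or.inr hw)) ?_
    have h1 : (a.roots.card : ℝ) + v.roots.card ≤ M := by
      have : a.roots.card + v.roots.card ≤ M := by omega
      exact_mod_cast this
    have h2 : (k : ℝ) ≤ p.roots.card := by exact_mod_cast hcardK
    have h3 := ragl_bound Metric.diam_nonneg hM0 (Nat.cast_nonneg k) hsqrt hε hδ1 hδ2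
    calc _ ≤ (M : ℝ) / r := by gcongr
      _ < k * (δ / (Metric.diam K + δ) ^ 2) := h3
      _ ≤ _ := by gcongr
  have hKU : K ⊆ U := Metric.self_subset_thickening hδ0 K
  have hcount := rootCount_add_eq (U := U) Metric.isOpen_thickening hK.thickening (hne.mono hKU) hrouche
  have hN : derivative p * a * v + p * (derivative a * v - a * derivative v) =
      derivative u * v - u * derivative v := by
    rw [hupa, derivative_mul (f := p) (g := a)]
    ring
  have hp'0 : derivative p ≠ 0 := by
    intro h
    have h1 := derivative_eq_zero.1 h
    rw [(IsAlgClosed.splits p).natDegree_eq_card_roots] at h1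
    omega
  rw [hN, rootCount_mul (mul_ne_zero (mul_ne_zero hp'0 ha0) hv0),
    rootCount_mul (mul_ne_zero hp'0 ha0)] at hcount
  have h1 := card_roots_sub_one_le_rootCount_derivative hconv hKU hpK
  have h2 := rootCount_wronskian_le f U
  rw [← hu, ← hv] at h2
  have h3 : numCrit f U ≤ numCrit f (Metric.thickening ε K) :=
    rootCount_mono _ (Metric.thickening_mono hδ2.le K)
  omega

end GaussLucas

theorem corollary2 (K : Set ℂ) (hK : Bornology.IsBounded K) (hconv : Convex ℝ K)
    (n k : ℕ) (hk : 0 < k) (hkn : k < n)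
    (hsqrt : 4 * ((n : ℝ) - (k : ℝ)) < Real.sqrt (k : ℝ))
    (ε : ℝ)
    (hε : 4 * Metric.diam K * ((n : ℝ) - (k : ℝ)) /
      (Real.sqrt (k : ℝ) - 4 * ((n : ℝ) - (k : ℝ))) < ε) :
    GaussLucas.RAGL K n k ε :=
  GaussLucas.ragl_of_convex K hK hconv n k hk hkn hsqrt ε hε
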